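/- Let $X=\{X(t),t\in T\}$ be a real-valued max-infinitely divisible process, i.e. for every $n\ge 1$ it has the same finite-dimensional distributions as the pointwise maximum of some $n$ i.i.d. processes, and assume $\operatorname{ess\,inf}X(t)=0$ for every $t\in T$. For a $\sigma$-finite measure space $(\Omega,\mathcal B,\mu)$ let $\mathcal L^\vee(\Omega,\mathcal B,\mu)$ be the set of measurable $f:\Omega\to\mathbb R$ with $f\ge 0$ $\mu$-a.e. and $\mu\{f>a\}<\infty$ for all $a>0$. A family $\{f_t,t\in T\}\subset\mathcal L^\vee(\Omega,\mathcal B,\mu)$ is a spectral representation of $X$ if $X$ has the same finite-dimensional distributions as $\{\sup_{i\in J}f_t(U_i),\,t\in T\}$, where $\{U_i,i\in J\}$ is a Poisson point process on $(\Omega,\mathcal B)$ with intensity $\mu$ ($J$ at most countable, possibly random) and the supremum is $0$ if there are no points. It is minimal if (a) for every $B\in\mathcal B$ there is $A\in\sigma\{f_t,t\in T\}$ with $\mu(A\triangle B)=0$, and (b) there is no $B\in\mathcal B$ with $\mu(B)>0$ such that for every $t\in T$, $f_t=0$ $\mu$-a.e. on $B$. A $\sigma$-finite Borel space is a measurable space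 isomorphic to a complete separable metric space with its Borel $\sigma$-algebra, endowed with a $\sigma$-finite measure. Let $\{f^{(i)}_t,t\in T\}$, $i=1,2$, be two minimal spectral representations of $X$, defined on $\sigma$-finite measure spaces $(\Omega_i,\mathcal B_i,\mu_i)$, with $\Omega_1\ne\emptyset$. (i) If $(\Omega_1,\mathcal B_1,\mu_1)$ is a $\sigma$-finite Borel space, then there is a measurable map $\Phi:\Omega_2\to\Omega_1$ such that $\mu_1=\mu_2\circ\Phi^{-1}$ and, for every $t\in T$, $f^{(2)}_t=f^{(1)}_t\circ\Phi$ $\mu_2$-a.e. (ii) If both $(\Omega_i,\mathcal B_i,\mu_i)$ are $\sigma$-finite Borel spaces, then every map $\Phi$ as in (i) is an isomorphism of measure spaces modulo null sets, i.e. there are null sets $A_2\in\mathcal B_2$ and $A_1\in\mathcal B_1$ such that $\Phi$ restricts to a measure-preserving bijection $\Omega_2\setminus A_2\to\Omega_1\setminus A_1$ that is measurable together with its inverse; and $\Phi$ is unique modulo null sets: any two maps as in (i) agree $\mu_2$-a.e. -/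

import Mathlib

open MeasureTheory ProbabilityTheory

universe u v w

/-- Equality of all finite-dimensional distributions of two real-valued processes, possibly
defined on different probability spaces. -/
def SameFDD {T : Type*} {E S : Type*} [MeasurableSpace E] [MeasurableSpace S]
    (X : T → E → ℝ) (P : Measure E) (Y : T → S → ℝ) (Q : Measure S) : Prop :=
  ∀ I : Finset T, IdentDistrib (fun e (t : I) => X t e) (fun s (t : I) => Y t s) P Q

/-- A process is max-infinitely divisible if, for every `n ≥ 1`, it has the same
finite-dimensional distributions as the pointwise maximum of `n` independent identically
distributed processes. (The i.i.d. processes can always be realised on the canonical space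
`Fin n → T → ℝ`, so that letting `S` range over the universe of `T` is no restriction.) -/
def IsMaxID {T : Type u} {E : Type*} [MeasurableSpace E] (X : T → E → ℝ) (P : Measure E) : Prop :=
  ∀ n : ℕ, 1 ≤ n →
    ∃ (S : Type u) (_ : MeasurableSpace S) (Q : Measure S) (Y : Fin n → T → S → ℝ),
      IsProbabilityMeasure Q ∧ (∀ i t, Measurable (Y i t)) ∧
      iIndepFun (fun i s (t : T) => Y i t s) Q ∧
      (∀ i j, IdentDistrib (fun s (t : T) => Y i t s) (fun s (t : T) => Y j t s) Q Q) ∧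
      SameFDD X P (fun t s => ⨆ i, Y i t s) Q

/-- The number of points, counted with multiplicity, of the configuration `U · s` that lie in `A`.
A random at most countable family of points of `Ω` is encoded as a sequence
`U : ℕ → S → Option Ω`, where `U n s = none` means that the `n`-th point is absent. -/
noncomputable def pointCount {Ω S : Type*} (U : ℕ → S → Option Ω) (A : Set Ω) (s : S) : ℕ∞ :=
  {n : ℕ | ∃ ω ∈ A, U n s = some ω}.encard

/-- The random at most countable family of points `U`, defined on the probability space `(S, Q)`,
is a Poisson point process on `Ω` with intensity measure `μ`. -/
structure IsPoissonPointProcess {Ω S : Type*} [MeasurableSpace Ω] [MeasurableSpace S]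
    (U : ℕ → S → Option Ω) (Q : Measure S) (μ : Measure Ω) : Prop where
  /-- each point is a random element of `Ω`, defined on a measurable event -/
  measurable : ∀ (n : ℕ) (A : Set Ω), MeasurableSet A →
    MeasurableSet {s | ∃ ω ∈ A, U n s = some ω}
  /-- the number of points in a set of finite measure is Poisson distributed -/
  poisson : ∀ A : Set Ω, MeasurableSet A → μ A ≠ ⊤ →
    HasLaw (pointCount U A) ((poissonMeasure (μ A).toNNReal).map (Nat.cast : ℕ → ℕ∞)) Q
  /-- a set of infinite measure contains infinitely many points -/
  infinite : ∀ A : Set Ω, MeasurableSet A → μ A = ⊤ → ∀ᵐ s ∂Q, pointCount U A s = ⊤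
  /-- the numbers of points in disjoint sets are independent -/
  indep : ∀ (k : ℕ) (A : Fin k → Set Ω), (∀ i, MeasurableSet (A i)) →
    Pairwise (Function.onFun Disjoint A) → iIndepFun (fun i => pointCount U (A i)) Q

/-- The stochastic max-integral: the supremum of `f` over the points of the process, and `0` if
there are no points (`sSup ∅ = 0` in `ℝ`). -/
noncomputable def maxIntegral {Ω S : Type*} (U : ℕ → S → Option Ω) (f : Ω → ℝ) (s : S) : ℝ :=
  sSup {x : ℝ | ∃ n ω, U n s = some ω ∧ f ω = x}

/-- The class of admissible integrands of the max-integral. -/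
structure MemLMax {Ω : Type*} [MeasurableSpace Ω] (f : Ω → ℝ) (μ : Measure Ω) : Prop where
  measurable : Measurable f
  nonneg : ∀ᵐ ω ∂μ, 0 ≤ f ω
  finite : ∀ a : ℝ, 0 < a → μ {ω | a < f ω} < ⊤

/-- `f` is a spectral representation of the process `X` over `(Ω, μ)`: the process has the same
finite-dimensional distributions as the max-integrals of the `f t` with respect to a Poisson point
process with intensity `μ`. (A Poisson point process with `σ`-finite intensity exists on
some probability space in the universe of `Ω`, and the finite-dimensional distributions of the
max-integrals do not depend on its choice.) -/
def IsSpectralRepresentation {T E : Type*} {Ω : Type w} [MeasurableSpace E] [MeasurableSpace Ω]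
    (X : T → E → ℝ) (P : Measure E) (f : T → Ω → ℝ) (μ : Measure Ω) : Prop :=
  (∀ t, MemLMax (f t) μ) ∧
    ∃ (S : Type w) (_ : MeasurableSpace S) (Q : Measure S) (U : ℕ → S → Option Ω),
      IsProbabilityMeasure Q ∧ IsPoissonPointProcess U Q μ ∧
      SameFDD X P (fun t => maxIntegral U (f t)) Q

/-- Minimality of a family of functions: it generates the `σ`-algebra up to null sets and has full
support. -/
structure IsMinimalFamily {T Ω : Type*} [MeasurableSpace Ω] (f : T → Ω → ℝ) (μ : Measure Ω) :
    Prop where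
  generates : ∀ B : Set Ω, MeasurableSet B →
    ∃ A : Set Ω, MeasurableSet[⨆ t, MeasurableSpace.comap (f t) inferInstance] A ∧
      μ (symmDiff A B) = 0
  fullSupport : ¬ ∃ B : Set Ω, MeasurableSet B ∧ 0 < μ B ∧ ∀ t, ∀ᵐ ω ∂μ.restrict B, f t ω = 0

/-- A minimal spectral representation of `X`. -/
def IsMinimalSpectralRepresentation {T E : Type*} {Ω : Type w} [MeasurableSpace E]
    [MeasurableSpace Ω] (X : T → E → ℝ) (P : Measure E) (f : T → Ω → ℝ) (μ : Measure Ω) : Prop :=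
  IsSpectralRepresentation X P f μ ∧ IsMinimalFamily f μ

/-- `Φ : Ω → Ω'` is an isomorphism modulo null sets of the measure spaces `(Ω, μ)` and `(Ω', μ')`:
off measurable null sets `A` and `A'` it is a bijection `Aᶜ → A'ᶜ`, measurable in both
directions, that preserves the measure. -/
def IsMeasureSpaceIso {Ω Ω' : Type*} [MeasurableSpace Ω] [MeasurableSpace Ω'] (Φ : Ω → Ω')
    (μ : Measure Ω) (μ' : Measure Ω') : Prop :=
  ∃ (A : Set Ω) (A' : Set Ω'), MeasurableSet A ∧ MeasurableSet A' ∧ μ A = 0 ∧ μ' A' = 0 ∧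
    ∃ e : (Aᶜ : Set Ω) ≃ᵐ (A'ᶜ : Set Ω'), (∀ ω : (Aᶜ : Set Ω), (e ω : Ω') = Φ ω) ∧
      ∀ B : Set Ω, MeasurableSet B → B ⊆ Aᶜ → μ B = μ' (Φ '' B)

/-!
The process determines the exponent measure of any of its spectral representations, that is the
image of the intensity measure on `T → ℝ`: the probability that `X` stays below finitely many
positive levels is the void probability of a Poisson process, hence the exponential of minus the
exponent measure of the complementary set. These values fix the exponent measure on each
`{x | x t ≠ 0}`, and full support excludes any further mass, even for uncountable `T`.

If moreover `f₁` generates the `σ`-algebra of a standard Borel space up to null sets, then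
`ω ↦ (f₁ t ω)_t` has a measurable left inverse `r` almost everywhere, and `Φ ω = r (f₂ t ω)_t` is
the required map. If `f₂` generates as well, then so does every such `Φ`; therefore `Φ` is injective
off a null set, and the Lusin–Souslin theorem makes it an isomorphism.
-/

section EssentialCover

variable {ι α β : Type*} [MeasurableSpace α] [MeasurableSpace β]

theorem exists_countable_forall_ae_le_biUnion (μ : Measure α) [SFinite μ] {s : ι → Set α}
    (hs : ∀ i, MeasurableSet (s i)) :
    ∃ D : Set ι, D.Countable ∧ ∀ i, s i ≤ᵐ[μ] ⋃ j ∈ D, s j := by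
  let mass : {D : Set ι // D.Countable} → ENNReal := fun D => μ.toFinite (⋃ j ∈ D.1, s j)
  have : Nonempty {D : Set ι // D.Countable} := ⟨⟨∅, Set.countable_empty⟩⟩
  obtain ⟨u, -, hu, hmem⟩ :=
    exists_seq_tendsto_sSup (Set.range_nonempty mass) (OrderTop.bddAbove _)
  choose D hD using hmem
  let D' : Set ι := ⋃ n, (D n).1
  have hD' : D'.Countable := Set.countable_iUnion fun n => (D n).2
  have hmax : ∀ A : {D : Set ι // D.Countable}, mass A ≤ μ.toFinite (⋃ j ∈ D', s j) := fun A =>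
    (le_sSup (Set.mem_range_self A)).trans <| le_of_tendsto' hu fun n => hD n ▸
      measure_mono (Set.biUnion_subset_biUnion_left (Set.subset_iUnion (fun n => (D n).1) n))
  refine ⟨D', hD', fun i => ?_⟩
  have hinsert : (⋃ j ∈ D', s j) =ᵐ[μ.toFinite] ⋃ j ∈ insert i D', s j :=
    ae_eq_of_subset_of_measure_ge (Set.biUnion_subset_biUnion_left (Set.subset_insert i D'))
      (hmax ⟨_, hD'.insert i⟩) (MeasurableSet.biUnion hD' fun j _ => hs j).nullMeasurableSet
      (measure_ne_top _ _)
  rw [ae_toFinite] at hinsert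
  exact (Set.subset_biUnion_of_mem (u := s) (Set.mem_insert i D')).eventuallyLE.trans
    hinsert.symm.le

/-- The sets `s i`, of which there may be uncountably many, cover the space up to a `μ`-null set, in
the sense that a measurable set meeting each of them in a null set is null. For the supports of a
family of functions this is condition (b) of minimality. -/
def IsEssentialCover (s : ι → Set α) (μ : Measure α) : Prop :=
  ∀ N : Set α, MeasurableSet N → (∀ i, μ (N ∩ s i) = 0) → μ N = 0

theorem IsEssentialCover.map {s : ι → Set β} {μ : Measure α} {g : α → β}
    (h : IsEssentialCover (fun i => g ⁻¹' s i) μ) (hg : Measurable g)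
    (hs : ∀ i, MeasurableSet (s i)) : IsEssentialCover s (μ.map g) := fun N hN hnull => by
  rw [Measure.map_apply hg hN]
  refine h _ (hg hN) fun i => ?_
  rw [← Set.preimage_inter, ← Measure.map_apply hg (hN.inter (hs i))]
  exact hnull i

theorem IsEssentialCover.measure_eq {s : ι → Set α} {μ ν : Measure α} [SFinite μ]
    (hμ : IsEssentialCover s μ) (hν : IsEssentialCover s ν) (hs : ∀ i, MeasurableSet (s i))
    (h : ∀ i, μ.restrict (s i) = ν.restrict (s i)) : μ = ν := by
  obtain ⟨D, hD, hcover⟩ := exists_countable_forall_ae_le_biUnion μ hs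
  have hcompl : MeasurableSet (⋃ j ∈ D, s j)ᶜ := (MeasurableSet.biUnion hD fun j _ => hs j).compl
  have hnull : ∀ i, μ ((⋃ j ∈ D, s j)ᶜ ∩ s i) = 0 := fun i => by
    rw [Set.inter_comm, ← Set.sdiff_eq]
    exact ae_le_set.1 (hcover i)
  have hμD : μ (⋃ j ∈ D, s j)ᶜ = 0 := hμ _ hcompl hnull
  have hνD : ν (⋃ j ∈ D, s j)ᶜ = 0 := hν _ hcompl fun i => by
    rw [← Measure.restrict_apply hcompl, ← h i, Measure.restrict_apply hcompl, hnull i]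
  rw [← Measure.restrict_eq_self_of_ae_mem (mem_ae_iff.2 hμD),
    ← Measure.restrict_eq_self_of_ae_mem (mem_ae_iff.2 hνD)]
  exact (Measure.restrict_biUnion_congr hD).2 fun i _ => h i

theorem IsMinimalFamily.isEssentialCover_support {T : Type*} {f : T → α → ℝ} {μ : Measure α}
    (h : IsMinimalFamily f μ) : IsEssentialCover (fun t => Function.support (f t)) μ := by
  refine fun N hN hnull => by_contra fun hpos => h.fullSupport
    ⟨N, hN, pos_iff_ne_zero.2 hpos, fun t => (ae_restrict_iff' hN).2 ?_⟩
  filter_upwards [measure_eq_zero_iff_ae_notMem.1 (hnull t)] with ω hω hωN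
  exact by_contra fun hne => hω ⟨hωN, hne⟩

end EssentialCover

section LowerBox

variable {T : Type*}

/-- The set of all `x : T → ℝ` with `x t < b` for each of finitely many pairs `(t, b)`. The
finite-dimensional distribution functions of a process are its probabilities of lying in these
sets, and the pair encoding makes them a `π`-system. -/
def lowerBox (K : Finset (T × ℝ)) : Set (T → ℝ) := {x | ∀ k ∈ K, x k.1 < k.2}

theorem lowerBox_eq_biInter (K : Finset (T × ℝ)) : lowerBox K = ⋂ k ∈ K, {x | x k.1 < k.2} := by
  ext
  simp [lowerBox]

theorem measurableSet_lowerBox (K : Finset (T × ℝ)) : MeasurableSet (lowerBox K) := by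
  rw [lowerBox_eq_biInter]
  exact K.measurableSet_biInter fun k _ =>
    measurableSet_lt (measurable_pi_apply _) measurable_const

theorem lowerBox_union [DecidableEq (T × ℝ)] (K L : Finset (T × ℝ)) :
    lowerBox (K ∪ L) = lowerBox K ∩ lowerBox L := by
  ext
  simp [lowerBox, or_imp, forall_and]

theorem isPiSystem_range_lowerBox : IsPiSystem (Set.range (lowerBox (T := T))) := by
  classical
  rintro _ ⟨K, rfl⟩ _ ⟨L, rfl⟩ -
  exact ⟨K ∪ L, lowerBox_union K L⟩

theorem pi_eq_generateFrom_range_lowerBox :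
    (MeasurableSpace.pi : MeasurableSpace (T → ℝ)) =
      MeasurableSpace.generateFrom (Set.range lowerBox) := by
  refine le_antisymm (iSup_le fun t => ?_) (MeasurableSpace.generateFrom_le ?_)
  · rw [← measurable_iff_comap_le]
    refine measurable_of_Iio (mδ := MeasurableSpace.generateFrom _) fun b => ?_
    refine MeasurableSpace.measurableSet_generateFrom ⟨{(t, b)}, ?_⟩
    ext
    simp [lowerBox]
  · rintro _ ⟨K, rfl⟩
    exact measurableSet_lowerBox K

theorem measure_lowerBox_inter_le [DecidableEq T] {ν : Measure (T → ℝ)} {K : Finset (T × ℝ)}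
    (hK : ν (lowerBox K)ᶜ ≠ ⊤) (t : T) (a : ℝ) :
    ν (lowerBox K ∩ {x | a ≤ x t}) = ν (lowerBox (insert (t, a) K))ᶜ - ν (lowerBox K)ᶜ := by
  have hinsert : lowerBox (insert (t, a) K) = {x | x t < a} ∩ lowerBox K := by
    simp only [lowerBox_eq_biInter, Finset.set_biInter_insert]
  have hdiff : lowerBox K ∩ {x | a ≤ x t} = (lowerBox (insert (t, a) K))ᶜ \ (lowerBox K)ᶜ := by
    ext x
    simp only [hinsert, Set.mem_inter_iff, Set.mem_ofPred_eq, Set.mem_sdiff, Set.mem_compl_iff,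
      not_and, not_not, ← not_lt]
    tauto
  rw [hdiff, measure_sdiff (Set.compl_subset_compl.2 (hinsert ▸ Set.inter_subset_right))
    (measurableSet_lowerBox K).compl.nullMeasurableSet hK]

variable {ν₁ ν₂ : Measure (T → ℝ)}

theorem restrict_le_eq_of_measure_compl_lowerBox_eq (h₁ : ∀ t, ∀ᵐ x ∂ν₁, 0 ≤ x t)
    (h₂ : ∀ t, ∀ᵐ x ∂ν₂, 0 ≤ x t)
    (hfin : ∀ K : Finset (T × ℝ), (∀ k ∈ K, 0 < k.2) → ν₁ (lowerBox K)ᶜ ≠ ⊤)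
    (heq : ∀ K : Finset (T × ℝ), (∀ k ∈ K, 0 < k.2) → ν₁ (lowerBox K)ᶜ = ν₂ (lowerBox K)ᶜ)
    (t : T) {a : ℝ} (ha : 0 < a) :
    ν₁.restrict {x | a ≤ x t} = ν₂.restrict {x | a ≤ x t} := by
  classical
  have hnull : ∀ {ν : Measure (T → ℝ)}, (∀ t, ∀ᵐ x ∂ν, 0 ≤ x t) → ∀ {K : Finset (T × ℝ)} {k},
      k ∈ K → k.2 ≤ 0 → ν (lowerBox K ∩ {x | a ≤ x t}) = 0 := fun hν _ k hk hk0 =>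
    measure_mono_null (fun x hx => not_le.2 ((hx.1 k hk).trans_le hk0)) (ae_iff.1 (hν k.1))
  have hbox : ∀ K : Finset (T × ℝ), ν₁.restrict {x | a ≤ x t} (lowerBox K) =
      ν₂.restrict {x | a ≤ x t} (lowerBox K) := fun K => by
    rw [Measure.restrict_apply (measurableSet_lowerBox K),
      Measure.restrict_apply (measurableSet_lowerBox K)]
    by_cases hK : ∀ k ∈ K, 0 < k.2
    · rw [measure_lowerBox_inter_le (hfin K hK), measure_lowerBox_inter_le (heq K hK ▸ hfin K hK),
        heq K hK, heq _ ((Finset.forall_mem_insert _ _ _).2 ⟨ha, hK⟩)]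
    · push Not at hK
      obtain ⟨k, hk, hk0⟩ := hK
      rw [hnull h₁ hk hk0, hnull h₂ hk hk0]
  have huniv : lowerBox (∅ : Finset (T × ℝ)) = Set.univ := by simp [lowerBox]
  have hfinite : IsFiniteMeasure (ν₁.restrict {x | a ≤ x t}) := by
    refine ⟨?_⟩
    have : {x : T → ℝ | a ≤ x t} = (lowerBox {(t, a)})ᶜ := by
      ext
      simp [lowerBox]
    rw [Measure.restrict_apply_univ, this]
    exact (hfin _ (by simpa using ha)).lt_top
  refine ext_of_generate_finite _ pi_eq_generateFrom_range_lowerBox isPiSystem_range_lowerBox ?_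
    (huniv ▸ hbox ∅)
  rintro _ ⟨K, rfl⟩
  exact hbox K

theorem restrict_ne_zero_eq_of_measure_compl_lowerBox_eq (h₁ : ∀ t, ∀ᵐ x ∂ν₁, 0 ≤ x t)
    (h₂ : ∀ t, ∀ᵐ x ∂ν₂, 0 ≤ x t)
    (hfin : ∀ K : Finset (T × ℝ), (∀ k ∈ K, 0 < k.2) → ν₁ (lowerBox K)ᶜ ≠ ⊤)
    (heq : ∀ K : Finset (T × ℝ), (∀ k ∈ K, 0 < k.2) → ν₁ (lowerBox K)ᶜ = ν₂ (lowerBox K)ᶜ)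
    (t : T) : ν₁.restrict {x | x t ≠ 0} = ν₂.restrict {x | x t ≠ 0} := by
  have hpos : {x : T → ℝ | 0 < x t} = ⋃ n : ℕ, {x | 1 / ((n : ℝ) + 1) ≤ x t} := by
    ext x
    simp only [Set.mem_ofPred_eq, Set.mem_iUnion]
    exact ⟨fun hx => (exists_nat_one_div_lt hx).imp fun _ => le_of_lt,
      fun ⟨_, hn⟩ => Nat.one_div_pos_of_nat.trans_le hn⟩
  have hae : ∀ {ν : Measure (T → ℝ)}, (∀ t, ∀ᵐ x ∂ν, 0 ≤ x t) →
      ({x | x t ≠ 0} : Set (T → ℝ)) =ᵐ[ν] {x | 0 < x t} := fun hν => by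
    refine Filter.eventuallyEq_set.2 ?_
    filter_upwards [hν t] with x hx using hx.lt_iff_ne'.symm
  rw [Measure.restrict_congr_set (hae h₁), Measure.restrict_congr_set (hae h₂), hpos,
    Measure.restrict_iUnion_congr]
  exact fun n => restrict_le_eq_of_measure_compl_lowerBox_eq h₁ h₂ hfin heq t
    Nat.one_div_pos_of_nat

end LowerBox

theorem sSup_lt_iff_of_finite_inter_Ioi {α : Type*} [ConditionallyCompleteLinearOrder α]
    {V : Set α} {a b : α} (hempty : sSup ∅ < a) (hba : b < a) (hV : (V ∩ Set.Ioi b).Finite) :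
    sSup V < a ↔ ∀ x ∈ V, x < a := by
  rcases V.eq_empty_or_nonempty with rfl | hne
  · simpa using hempty
  have hfin := hV.insert b
  have hle : ∀ x ∈ V, x ≤ sSup (insert b (V ∩ Set.Ioi b)) := fun x hx => by
    rcases le_or_gt x b with hxb | hbx
    · exact hxb.trans (le_csSup hfin.bddAbove (Set.mem_insert _ _))
    · exact le_csSup hfin.bddAbove (Or.inr ⟨hx, hbx⟩)
  refine ⟨fun h x hx => (le_csSup ⟨_, hle⟩ hx).trans_lt h,
    fun h => (csSup_le hne hle).trans_lt ((hfin.csSup_lt_iff (Set.insert_nonempty _ _)).2 ?_)⟩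
  rintro x (rfl | hx)
  · exact hba
  · exact h x hx.1

theorem pointCount_eq_zero_iff {Ω S : Type*} {U : ℕ → S → Option Ω} {A : Set Ω} {s : S} :
    pointCount U A s = 0 ↔ ∀ n ω, U n s = some ω → ω ∉ A := by
  simp only [pointCount, Set.encard_eq_zero, Set.eq_empty_iff_forall_notMem, Set.mem_ofPred_eq,
    not_exists, not_and']

section MaxIntegral

variable {Ω S : Type*} [MeasurableSpace Ω] {U : ℕ → S → Option Ω} {μ : Measure Ω}

theorem MemLMax.measure_le_lt_top {f : Ω → ℝ} (hf : MemLMax f μ) {a : ℝ} (ha : 0 < a) :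
    μ {ω | a ≤ f ω} < ⊤ :=
  (measure_mono fun _ h => (half_lt_self ha).trans_le h).trans_lt (hf.finite _ (half_pos ha))

variable [MeasurableSpace S] {Q : Measure S}

namespace IsPoissonPointProcess

theorem ae_pointCount_ne_top (hU : IsPoissonPointProcess U Q μ) {A : Set Ω}
    (hA : MeasurableSet A) (hμ : μ A ≠ ⊤) : ∀ᵐ s ∂Q, pointCount U A s ≠ ⊤ := by
  have htop : (Nat.cast : ℕ → ℕ∞) ⁻¹' {x | x = ⊤} = ∅ := by
    ext
    simp
  simp only [ae_iff, ne_eq, not_not]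
  rw [(hU.poisson A hA hμ).measure_eq (p := fun n => n = ⊤) .of_discrete,
    Measure.map_apply .of_discrete .of_discrete, htop, measure_empty]

theorem measure_pointCount_eq_zero (hU : IsPoissonPointProcess U Q μ) {A : Set Ω}
    (hA : MeasurableSet A) (hμ : μ A ≠ ⊤) :
    Q {s | pointCount U A s = 0} = ENNReal.ofReal (Real.exp (-(μ A).toReal)) := by
  have hzero : (Nat.cast : ℕ → ℕ∞) ⁻¹' {x | x = 0} = {0} := by
    ext
    simp
  rw [(hU.poisson A hA hμ).measure_eq (p := fun n => n = 0) .of_discrete,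
    Measure.map_apply .of_discrete .of_discrete, hzero, poissonMeasure_singleton]
  simp [ENNReal.coe_toNNReal_eq_toReal]

/- Only finitely many points exceed the level `a / 2`, so the supremum cannot approach `a` through
smaller values. -/
theorem ae_maxIntegral_lt_iff (hU : IsPoissonPointProcess U Q μ) {f : Ω → ℝ} (hf : MemLMax f μ)
    {a : ℝ} (ha : 0 < a) :
    ∀ᵐ s ∂Q, maxIntegral U f s < a ↔ pointCount U {ω | a ≤ f ω} s = 0 := by
  have hmeas : MeasurableSet {ω | a / 2 < f ω} := measurableSet_lt measurable_const hf.measurable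
  filter_upwards [hU.ae_pointCount_ne_top hmeas (hf.finite _ (half_pos ha)).ne] with s hs
  have hfin : {n : ℕ | ∃ ω ∈ {ω | a / 2 < f ω}, U n s = some ω}.Finite :=
    Set.encard_ne_top_iff.1 hs
  have hV : ({x : ℝ | ∃ n ω, U n s = some ω ∧ f ω = x} ∩ Set.Ioi (a / 2)).Finite := by
    refine (hfin.image fun n => ((U n s).map f).getD 0).subset ?_
    rintro _ ⟨⟨n, ω, hn, rfl⟩, hx⟩
    exact ⟨n, ⟨ω, hx, hn⟩, by simp [hn]⟩
  rw [maxIntegral, sSup_lt_iff_of_finite_inter_Ioi (Real.sSup_empty.trans_lt ha) (half_lt_self ha)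
    hV, pointCount_eq_zero_iff]
  simp only [Set.mem_ofPred_eq, not_le]
  exact ⟨fun h n ω hn => h _ ⟨n, ω, hn, rfl⟩, fun h x ⟨n, ω, hn, hx⟩ => hx ▸ h n ω hn⟩

end IsPoissonPointProcess

/-- The exponent measure of the max-integrals of the family `f` with respect to a Poisson point
process with intensity `μ`: the intensity of the random functions `t ↦ f t ω`, where `ω` runs
through the points. -/
noncomputable def exponentMeasure {T : Type*} (f : T → Ω → ℝ) (μ : Measure Ω) : Measure (T → ℝ) :=
  μ.map fun ω t => f t ω

variable {T : Type*} {f : T → Ω → ℝ} {K : Finset (T × ℝ)}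

theorem exponentMeasure_compl_lowerBox_ne_top (hf : ∀ t, MemLMax (f t) μ)
    (hK : ∀ k ∈ K, 0 < k.2) : exponentMeasure f μ (lowerBox K)ᶜ ≠ ⊤ := by
  rw [exponentMeasure, Measure.map_apply (measurable_pi_iff.2 fun t => (hf t).measurable)
    (measurableSet_lowerBox K).compl]
  refine ((measure_mono fun ω hω => ?_).trans_lt (measure_biUnion_lt_top K.finite_toSet
    fun {k} hk => (hf k.1).measure_le_lt_top (hK k hk))).ne
  simpa [lowerBox] using hω

theorem ae_exponentMeasure_nonneg (hf : ∀ t, MemLMax (f t) μ) (t : T) :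
    ∀ᵐ x ∂exponentMeasure f μ, 0 ≤ x t :=
  (ae_map_iff (measurable_pi_iff.2 fun t => (hf t).measurable).aemeasurable
    (measurableSet_le measurable_const (measurable_pi_apply t))).2 (hf t).nonneg

theorem IsPoissonPointProcess.measure_maxIntegral_mem_lowerBox (hU : IsPoissonPointProcess U Q μ)
    (hf : ∀ t, MemLMax (f t) μ) (hK : ∀ k ∈ K, 0 < k.2) :
    Q {s | (fun t => maxIntegral U (f t) s) ∈ lowerBox K} =
      ENNReal.ofReal (Real.exp (-(exponentMeasure f μ (lowerBox K)ᶜ).toReal)) := by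
  have hmeas : Measurable fun ω t => f t ω := measurable_pi_iff.2 fun t => (hf t).measurable
  have hC := (measurableSet_lowerBox K).compl
  have htop := exponentMeasure_compl_lowerBox_ne_top hf hK
  rw [exponentMeasure, Measure.map_apply hmeas hC] at htop ⊢
  rw [← hU.measure_pointCount_eq_zero (hmeas hC) htop]
  have hae : ∀ᵐ s ∂Q, ∀ k ∈ K,
      (maxIntegral U (f k.1) s < k.2 ↔ pointCount U {ω | k.2 ≤ f k.1 ω} s = 0) :=
    (ae_ball_iff K.countable_toSet).2 fun k hk => hU.ae_maxIntegral_lt_iff (hf k.1) (hK k hk)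
  refine measure_congr (Filter.eventuallyEq_set.2 ?_)
  filter_upwards [hae] with s hs
  calc (∀ k ∈ K, maxIntegral U (f k.1) s < k.2)
    _ ↔ ∀ k ∈ K, pointCount U {ω | k.2 ≤ f k.1 ω} s = 0 := forall₂_congr hs
    _ ↔ pointCount U ((fun ω t => f t ω) ⁻¹' (lowerBox K)ᶜ) s = 0 := by
      simp only [pointCount_eq_zero_iff, lowerBox, Set.mem_preimage, Set.mem_compl_iff,
        Set.mem_ofPred_eq, not_le, not_not]
      exact ⟨fun h n ω hn k hk => h k hk n ω hn, fun h k hk n ω hn => h n ω hn k hk⟩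

end MaxIntegral

section ExponentMeasure

variable {T E : Type*} [MeasurableSpace E] {X : T → E → ℝ} {P : Measure E}

theorem SameFDD.measure_mem_lowerBox {S : Type*} [MeasurableSpace S] {Y : T → S → ℝ}
    {Q : Measure S} (h : SameFDD X P Y Q) (K : Finset (T × ℝ)) :
    P {e | (fun t => X t e) ∈ lowerBox K} = Q {s | (fun t => Y t s) ∈ lowerBox K} := by
  classical
  have hC : MeasurableSet {x : K.image Prod.fst → ℝ |
      ∀ k : K, x ⟨k.1.1, Finset.mem_image_of_mem _ k.2⟩ < k.1.2} := by
    rw [Set.ofPred_forall]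
    exact MeasurableSet.iInter fun k => measurableSet_lt (measurable_pi_apply _) measurable_const
  simpa [lowerBox] using (h (K.image Prod.fst)).measure_mem_eq hC

theorem IsSpectralRepresentation.measure_mem_lowerBox {Ω : Type w} [MeasurableSpace Ω]
    {f : T → Ω → ℝ} {μ : Measure Ω} (h : IsSpectralRepresentation X P f μ)
    {K : Finset (T × ℝ)} (hK : ∀ k ∈ K, 0 < k.2) :
    P {e | (fun t => X t e) ∈ lowerBox K} =
      ENNReal.ofReal (Real.exp (-(exponentMeasure f μ (lowerBox K)ᶜ).toReal)) := by
  obtain ⟨hf, S, _, Q, U, _, hU, hfdd⟩ := h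
  rw [hfdd.measure_mem_lowerBox, hU.measure_maxIntegral_mem_lowerBox hf hK]

variable {Ω₁ : Type v} {Ω₂ : Type w} [MeasurableSpace Ω₁] [MeasurableSpace Ω₂]
  {f₁ : T → Ω₁ → ℝ} {f₂ : T → Ω₂ → ℝ} {μ₁ : Measure Ω₁} {μ₂ : Measure Ω₂}

theorem IsSpectralRepresentation.exponentMeasure_compl_lowerBox_eq
    (h₁ : IsSpectralRepresentation X P f₁ μ₁) (h₂ : IsSpectralRepresentation X P f₂ μ₂)
    {K : Finset (T × ℝ)} (hK : ∀ k ∈ K, 0 < k.2) :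
    exponentMeasure f₁ μ₁ (lowerBox K)ᶜ = exponentMeasure f₂ μ₂ (lowerBox K)ᶜ := by
  have h := (h₁.measure_mem_lowerBox hK).symm.trans (h₂.measure_mem_lowerBox hK)
  rwa [ENNReal.ofReal_eq_ofReal_iff (Real.exp_pos _).le (Real.exp_pos _).le, Real.exp_eq_exp,
    neg_inj, ENNReal.toReal_eq_toReal_iff' (exponentMeasure_compl_lowerBox_ne_top h₁.1 hK)
      (exponentMeasure_compl_lowerBox_ne_top h₂.1 hK)] at h

theorem IsSpectralRepresentation.exponentMeasure_eq [SFinite μ₁]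
    (h₁ : IsSpectralRepresentation X P f₁ μ₁) (h₂ : IsSpectralRepresentation X P f₂ μ₂)
    (hsupp₁ : IsEssentialCover (fun t => Function.support (f₁ t)) μ₁)
    (hsupp₂ : IsEssentialCover (fun t => Function.support (f₂ t)) μ₂) :
    exponentMeasure f₁ μ₁ = exponentMeasure f₂ μ₂ := by
  have hne : ∀ t, MeasurableSet {x : T → ℝ | x t ≠ 0} := fun t =>
    (measurableSet_eq_fun (measurable_pi_apply t) measurable_const).compl
  have hcover₁ : IsEssentialCover (fun t => {x | x t ≠ 0}) (exponentMeasure f₁ μ₁) :=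
    hsupp₁.map (measurable_pi_iff.2 fun t => (h₁.1 t).measurable) hne
  have hcover₂ : IsEssentialCover (fun t => {x | x t ≠ 0}) (exponentMeasure f₂ μ₂) :=
    hsupp₂.map (measurable_pi_iff.2 fun t => (h₂.1 t).measurable) hne
  have : SFinite (exponentMeasure f₁ μ₁) := inferInstanceAs (SFinite (μ₁.map _))
  exact hcover₁.measure_eq hcover₂ hne <| restrict_ne_zero_eq_of_measure_compl_lowerBox_eq
    (ae_exponentMeasure_nonneg h₁.1) (ae_exponentMeasure_nonneg h₂.1)
    (fun _ => exponentMeasure_compl_lowerBox_ne_top h₁.1)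
    (fun _ => h₁.exponentMeasure_compl_lowerBox_eq h₂)

end ExponentMeasure

section GeneratesUpToNull

variable {Ω Ω' Y : Type*} [MeasurableSpace Ω] [MeasurableSpace Ω'] [MeasurableSpace Y]
  {μ : Measure Ω} {μ' : Measure Ω'}

/-- `F` and `G` cannot be told apart by measurable sets, up to null sets. For maps into an
uncountable product this amounts to almost everywhere equality of each coordinate, and is weaker
than almost everywhere equality. -/
def PreimageAEEq (F G : Ω → Y) (μ : Measure Ω) : Prop :=
  ∀ C : Set Y, MeasurableSet C → F ⁻¹' C =ᵐ[μ] G ⁻¹' C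

theorem PreimageAEEq.symm {F G : Ω → Y} (h : PreimageAEEq F G μ) : PreimageAEEq G F μ :=
  fun C hC => (h C hC).symm

theorem PreimageAEEq.trans {F G H : Ω → Y} (hFG : PreimageAEEq F G μ)
    (hGH : PreimageAEEq G H μ) : PreimageAEEq F H μ :=
  fun C hC => (hFG C hC).trans (hGH C hC)

theorem preimageAEEq_pi_iff {T : Type*} {Z : T → Type*} [∀ t, MeasurableSpace (Z t)]
    [∀ t, MeasurableSpace.CountablySeparated (Z t)] {F G : Ω → ∀ t, Z t} :
    PreimageAEEq F G μ ↔ ∀ t, ∀ᵐ ω ∂μ, F ω t = G ω t := by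
  refine ⟨fun h t => Filter.EventuallyEq.of_forall_separating_preimage MeasurableSet fun A hA =>
    h _ (measurable_pi_apply t hA), fun h C hC => ?_⟩
  rw [MeasurableSpace.pi, MeasurableSpace.measurableSpace_iSup_eq] at hC
  induction C, hC using MeasurableSpace.generateFrom_induction with
  | hC C hC _ =>
    obtain ⟨t, A, -, rfl⟩ := hC
    refine Filter.eventuallyEq_set.2 ?_
    filter_upwards [h t] with ω hω
    simp only [Set.mem_preimage, hω]
  | empty => rfl
  | compl C _ ih => exact ih.compl
  | iUnion C _ ih =>
    simp only [Set.preimage_iUnion]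
    exact Filter.EventuallyEq.countable_iUnion ih

/-- Every measurable set is, up to a null set, the preimage of a measurable set under `F`. For
`F = fun ω t => f t ω` this is condition (a) of minimality of the family `f`. -/
def GeneratesUpToNull (F : Ω → Y) (μ : Measure Ω) : Prop :=
  ∀ B : Set Ω, MeasurableSet B → ∃ C : Set Y, MeasurableSet C ∧ F ⁻¹' C =ᵐ[μ] B

theorem IsMinimalFamily.generatesUpToNull {T : Type*} {f : T → Ω → ℝ}
    (h : IsMinimalFamily f μ) : GeneratesUpToNull (fun ω t => f t ω) μ := fun B hB => by
  obtain ⟨A, hA, hAB⟩ := h.generates B hB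
  have hcomap : (⨆ t, MeasurableSpace.comap (f t) inferInstance) =
      MeasurableSpace.comap (fun ω t => f t ω) MeasurableSpace.pi := by
    simp only [MeasurableSpace.pi, MeasurableSpace.comap_iSup, MeasurableSpace.comap_comp]
    rfl
  rw [hcomap] at hA
  obtain ⟨C, hC, rfl⟩ := hA
  exact ⟨C, hC, measure_symmDiff_eq_zero_iff.1 hAB⟩

namespace GeneratesUpToNull

theorem congr {F G : Ω → Y} (hF : GeneratesUpToNull F μ) (hFG : PreimageAEEq F G μ) :
    GeneratesUpToNull G μ := fun B hB => by
  obtain ⟨C, hC, hCB⟩ := hF B hB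
  exact ⟨C, hC, (hFG C hC).symm.trans hCB⟩

theorem of_comp {F : Ω' → Y} {Φ : Ω → Ω'} (h : GeneratesUpToNull (F ∘ Φ) μ) (hF : Measurable F) :
    GeneratesUpToNull Φ μ := fun B hB => by
  obtain ⟨C, hC, hCB⟩ := h B hB
  exact ⟨F ⁻¹' C, hF hC, hCB⟩

theorem ae_eq_of_preimageAEEq_comp [MeasurableSpace.CountablySeparated Ω] {F : Ω → Y}
    (hF : GeneratesUpToNull F μ) {Φ Ψ : Ω' → Ω} (hΦ : Filter.Tendsto Φ (ae μ') (ae μ))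
    (hΨ : Filter.Tendsto Ψ (ae μ') (ae μ)) (h : PreimageAEEq (F ∘ Φ) (F ∘ Ψ) μ') :
    Φ =ᵐ[μ'] Ψ := by
  refine Filter.EventuallyEq.of_forall_separating_preimage MeasurableSet fun B hB => ?_
  obtain ⟨C, hC, hCB⟩ := hF B hB
  exact (hCB.symm.comp_tendsto hΦ).trans ((h C hC).trans (hCB.comp_tendsto hΨ))

theorem exists_measurable_leftInverse [StandardBorelSpace Ω] [Nonempty Ω] {F : Ω → Y}
    (hF : GeneratesUpToNull F μ) : ∃ r : Y → Ω, Measurable r ∧ ∀ᵐ ω ∂μ, r (F ω) = ω := by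
  classical
  obtain ⟨code, hcode, hinj⟩ :=
    MeasurableSpace.measurable_injection_nat_bool_of_countablySeparated Ω
  obtain ⟨decode, hdecode, hleft⟩ := (hcode.measurableEmbedding hinj).exists_measurable_extend
    measurable_id fun _ => ‹Nonempty Ω›
  choose C hC hCae using fun n =>
    hF {ω | code ω n = true} (measurable_pi_iff.1 hcode n (measurableSet_singleton true))
  have hbits : Measurable fun y n => decide (y ∈ C n) :=
    measurable_pi_iff.2 fun n => measurable_to_bool (by simpa [Set.preimage] using hC n)
  refine ⟨fun y => decode fun n => decide (y ∈ C n), hdecode.comp hbits, ?_⟩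
  filter_upwards [ae_all_iff.2 fun n => (hCae n).mem_iff] with ω hω
  have hcodeω : (fun n => decide (F ω ∈ C n)) = code ω := by
    ext1 n
    exact Bool.eq_iff_iff.2 (decide_eq_true_iff.trans (hω n))
  rw [hcodeω]
  exact congr_fun hleft ω

theorem exists_measurePreserving [StandardBorelSpace Ω] [Nonempty Ω] {F : Ω → Y} {F' : Ω' → Y}
    (h : GeneratesUpToNull F μ) (hF : Measurable F) (hF' : Measurable F')
    (hmap : μ.map F = μ'.map F') :
    ∃ Φ : Ω' → Ω, MeasurePreserving Φ μ' μ ∧ PreimageAEEq F' (F ∘ Φ) μ' := by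
  obtain ⟨r, hr, hrF⟩ := h.exists_measurable_leftInverse
  refine ⟨r ∘ F', ⟨hr.comp hF', ?_⟩, fun C hC => ?_⟩
  · have hid : r ∘ F =ᵐ[μ] id := hrF
    rw [← Measure.map_map hr hF', ← hmap, Measure.map_map hr hF, Measure.map_congr hid,
      Measure.map_id]
  · have hiff : MeasurableSet {y | y ∈ C ↔ F (r y) ∈ C} :=
      measurableSet_setOfPred.2 <|
        (measurableSet_setOfPred.1 hC).iff (measurableSet_setOfPred.1 (hF.comp hr hC))
    have hae : ∀ᵐ y ∂μ.map F, y ∈ C ↔ F (r y) ∈ C := by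
      rw [ae_map_iff hF.aemeasurable hiff]
      filter_upwards [hrF] with ω hω
      rw [hω]
    rw [hmap, ae_map_iff hF'.aemeasurable hiff] at hae
    exact Filter.eventuallyEq_set.2 hae

theorem exists_injOn_compl [MeasurableSpace.CountablySeparated Ω] {Φ : Ω → Ω'}
    (h : GeneratesUpToNull Φ μ) : ∃ N, MeasurableSet N ∧ μ N = 0 ∧ Set.InjOn Φ Nᶜ := by
  obtain ⟨code, hcode, hinj⟩ :=
    MeasurableSpace.measurable_injection_nat_bool_of_countablySeparated Ω
  choose C _ hCae using fun n =>
    h {ω | code ω n = true} (measurable_pi_iff.1 hcode n (measurableSet_singleton true))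
  obtain ⟨N, hsub, hN, hN0⟩ :=
    exists_measurable_superset_of_null (ae_all_iff.2 fun n => (hCae n).mem_iff)
  have hmem : ∀ ω ∈ Nᶜ, ∀ n, Φ ω ∈ C n ↔ code ω n = true := fun ω hω =>
    not_not.1 fun hne => hω (hsub hne)
  refine ⟨N, hN, hN0, fun ω hω ω' hω' heq => hinj (funext fun n => ?_)⟩
  rw [Bool.eq_iff_iff, ← hmem ω hω, ← hmem ω' hω', heq]

end GeneratesUpToNull

theorem isMeasureSpaceIso_of_injOn [StandardBorelSpace Ω] [MeasurableSpace.CountablySeparated Ω']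
    {Φ : Ω → Ω'} (hΦ : MeasurePreserving Φ μ μ') {N : Set Ω} (hN : MeasurableSet N)
    (hN0 : μ N = 0) (hinj : Set.InjOn Φ Nᶜ) : IsMeasureSpaceIso Φ μ μ' := by
  have hemb : MeasurableEmbedding (Nᶜ.domRestrict Φ) := by
    have := hN.compl.standardBorel
    exact (hΦ.measurable.comp measurable_subtype_coe).measurableEmbedding hinj.injective
  have hpre : ∀ B ⊆ Nᶜ, Φ ⁻¹' (Φ '' B) =ᵐ[μ] B := fun B hBN => by
    refine Filter.eventuallyEq_set.2 ?_
    filter_upwards [measure_eq_zero_iff_ae_notMem.1 hN0] with ω hω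
    exact hinj.mem_image_iff hBN hω
  refine ⟨N, (Set.range (Nᶜ.domRestrict Φ))ᶜ, hN, hemb.measurableSet_range.compl, hN0, ?_, ?_⟩
  · rw [← hΦ.measure_preimage hemb.measurableSet_range.compl.nullMeasurableSet,
      Set.preimage_compl, Set.range_domRestrict, measure_congr (hpre Nᶜ subset_rfl).compl,
      compl_compl, hN0]
  · rw [compl_compl]
    refine ⟨hemb.equivRange, fun ω => congrArg Subtype.val (hemb.equivRange_apply ω),
      fun B hB hBN => ?_⟩
    have hB' := hB.image_of_measurable_injOn hΦ.measurable (hinj.mono hBN)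
    rw [← hΦ.measure_preimage hB'.nullMeasurableSet, measure_congr (hpre B hBN)]

theorem GeneratesUpToNull.isMeasureSpaceIso [StandardBorelSpace Ω]
    [MeasurableSpace.CountablySeparated Ω'] {Φ : Ω → Ω'} (h : GeneratesUpToNull Φ μ)
    (hΦ : MeasurePreserving Φ μ μ') : IsMeasureSpaceIso Φ μ μ' :=
  let ⟨_, hN, hN0, hinj⟩ := h.exists_injOn_compl
  isMeasureSpaceIso_of_injOn hΦ hN hN0 hinj

end GeneratesUpToNull

theorem mainTheorem1_general {T E : Type*} [MeasurableSpace E] {X : T → E → ℝ} {P : Measure E}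
    {Ω₁ : Type v} {Ω₂ : Type w} [MeasurableSpace Ω₁] [MeasurableSpace Ω₂] [Nonempty Ω₁]
    [StandardBorelSpace Ω₁] {μ₁ : Measure Ω₁} {μ₂ : Measure Ω₂} [SFinite μ₁]
    {f₁ : T → Ω₁ → ℝ} {f₂ : T → Ω₂ → ℝ} (h₁ : IsMinimalSpectralRepresentation X P f₁ μ₁)
    (h₂ : IsSpectralRepresentation X P f₂ μ₂)
    (hsupp₂ : IsEssentialCover (fun t => Function.support (f₂ t)) μ₂) :
    (∃ Φ : Ω₂ → Ω₁, Measurable Φ ∧ μ₁ = μ₂.map Φ ∧ ∀ t, ∀ᵐ ω ∂μ₂, f₂ t ω = f₁ t (Φ ω)) ∧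
    ∀ Φ : Ω₂ → Ω₁, Measurable Φ → μ₁ = μ₂.map Φ → (∀ t, ∀ᵐ ω ∂μ₂, f₂ t ω = f₁ t (Φ ω)) →
      (StandardBorelSpace Ω₂ → GeneratesUpToNull (fun ω t => f₂ t ω) μ₂ →
        IsMeasureSpaceIso Φ μ₂ μ₁) ∧
      ∀ Ψ : Ω₂ → Ω₁, AEMeasurable Ψ μ₂ → μ₁ = μ₂.map Ψ →
        (∀ t, ∀ᵐ ω ∂μ₂, f₂ t ω = f₁ t (Ψ ω)) → ∀ᵐ ω ∂μ₂, Ψ ω = Φ ω := by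
  have hF₁ : Measurable fun ω t => f₁ t ω := measurable_pi_iff.2 fun t => (h₁.1.1 t).measurable
  have hF₂ : Measurable fun ω t => f₂ t ω := measurable_pi_iff.2 fun t => (h₂.1 t).measurable
  refine ⟨?_, fun Φ hΦ hΦμ hΦf => ⟨fun _ hgen₂ => ?_, fun Ψ hΨ hΨμ hΨf => ?_⟩⟩
  · obtain ⟨Φ, hΦ, hΦf⟩ := h₁.2.generatesUpToNull.exists_measurePreserving hF₁ hF₂
      (h₁.1.exponentMeasure_eq h₂ h₁.2.isEssentialCover_support hsupp₂)
    exact ⟨Φ, hΦ.measurable, hΦ.map_eq.symm, preimageAEEq_pi_iff.1 hΦf⟩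
  · have hgen : GeneratesUpToNull Φ μ₂ := (hgen₂.congr (preimageAEEq_pi_iff.2 hΦf)).of_comp hF₁
    exact hgen.isMeasureSpaceIso ⟨hΦ, hΦμ.symm⟩
  · exact h₁.2.generatesUpToNull.ae_eq_of_preimageAEEq_comp (hΨμ ▸ Measure.tendsto_ae_map hΨ)
      (hΦμ ▸ Measure.tendsto_ae_map hΦ.aemeasurable)
      ((preimageAEEq_pi_iff.2 hΨf).symm.trans (preimageAEEq_pi_iff.2 hΦf))

theorem mainTheorem1 {T : Type u} {E : Type v} [MeasurableSpace E] (P : Measure E)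
    [IsProbabilityMeasure P] (X : T → E → ℝ) (hXmeas : ∀ t, Measurable (X t))
    (hXmax : IsMaxID X P) (hXinf : ∀ t, essInf (fun e => (X t e : EReal)) P = 0)
    {Ω₁ Ω₂ : Type*} [MeasurableSpace Ω₁] [MeasurableSpace Ω₂] [Nonempty Ω₁]
    (μ₁ : Measure Ω₁) (μ₂ : Measure Ω₂) [SigmaFinite μ₁] [SigmaFinite μ₂]
    (f₁ : T → Ω₁ → ℝ) (f₂ : T → Ω₂ → ℝ)
    (h₁ : IsMinimalSpectralRepresentation X P f₁ μ₁)
    (h₂ : IsMinimalSpectralRepresentation X P f₂ μ₂)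
    (hΩ₁ : StandardBorelSpace Ω₁) :
    (∃ Φ : Ω₂ → Ω₁, Measurable Φ ∧ μ₁ = μ₂.map Φ ∧
      ∀ t, ∀ᵐ ω ∂μ₂, f₂ t ω = f₁ t (Φ ω)) ∧
    (StandardBorelSpace Ω₂ →
      ∀ Φ : Ω₂ → Ω₁, Measurable Φ → μ₁ = μ₂.map Φ →
        (∀ t, ∀ᵐ ω ∂μ₂, f₂ t ω = f₁ t (Φ ω)) →
        IsMeasureSpaceIso Φ μ₂ μ₁ ∧
        ∀ Ψ : Ω₂ → Ω₁, AEMeasurable Ψ μ₂ → μ₁ = μ₂.map Ψ →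
          (∀ t, ∀ᵐ ω ∂μ₂, f₂ t ω = f₁ t (Ψ ω)) → ∀ᵐ ω ∂μ₂, Ψ ω = Φ ω) := by
  have general := mainTheorem1_general h₁ h₂.1 h₂.2.isEssentialCover_support
  exact ⟨general.1, fun hΩ₂ Φ hΦ hΦμ hΦf =>
    (general.2 Φ hΦ hΦμ hΦf).imp_left fun iso => iso hΩ₂ h₂.2.generatesUpToNull⟩
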